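/- Let $X$ and $Y$ be standard Borel spaces. An equivalence relation $E$ on a standard Borel space $X$ is \emph{countable} if all its classes are countable, and \emph{smooth} if there are a standard Borel space $W$ and a Borel map $f:X\to W$ with $x\mathrel{E}y\Leftrightarrow f(x)=f(y)$. The quotient $X/E$ carries the quotient $\sigma$-algebra. Write $\mathcal{C}^+=\{1,2,3,\dots\}\cup\{\aleph_0,2^{\aleph_0}\}$. Let $E\subseteq F$ be smooth countable equivalence relations on $X$. The \emph{local fine shape} of an $F$-class $C$ is the sequence $\mathrm{lfs}(E,F)(C)=\langle n_m : 1\le m\le\aleph_0\rangle$, where $n_m\in\{0,1,2,\dots,\aleph_0\}$ is the number of $E$-classes of cardinality $m$ contained in $C$. Let $\mathcal{S}$ be the set of all sequences $\langle n_m : 1\le m\le\aleph_0\rangle$ of elements of $\{0,1,2,\dots,\aleph_0\}$ that are not constantly $0$. The \emph{global fine shape} of $(E,F)$ is the function $\mathrm{gfs}(E,F)$ that assigns to each $\alpha\in\mathcal{S}$ the cardinality of the set of $F$-classes $C$ with $\mathrm{lfs}(E,F)(C)=\alpha$. Let $[\![\mathrm{lfs}(E,F)]\!]$ be the equivalence relation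 on $X/F$ under which two $F$-classes are equivalent iff they have the same local fine shape. A \emph{Borel parametrization} of an equivalence relation $D$ on a standard Borel space $Q$ is a Borel bijection $\phi:Q\to\bigsqcup_{m\in\mathcal{C}^+}(Z_m\times Y_m)$, where the $Z_m$ are pairwise disjoint (possibly empty) standard Borel spaces, the $Y_m$ are standard Borel spaces with $|Y_m|=m$, and for all $p,q\in Q$, $p\mathrel{D}q$ iff $\phi(p)$ and $\phi(q)$ have the same first coordinate in $\bigsqcup_m Z_m$. $D$ is \emph{Borel parametrized} if it has a Borel parametrization. (For $F$ smooth and countable, $X/F$ is standard Borel.) \textbf{Theorem.} Let $E\subseteq F$ and $E'\subseteq F'$ be smooth countable equivalence relations on the standard Borel spaces $X$ and $Y$, respectively, such that $[\![\mathrm{lfs}(E,F)]\!]$ (on $X/F$) and $[\![\mathrm{lfs}(E',F')]\!]$ (on $Y/F'$) are Borel parametrized. Then there is a Borel bijection $f:X\to Y$ such that for all $x,y\in X$ both $x\mathrel{E}y\Leftrightarrow f(x)\mathrel{E'}f(y)$ and $x\mathrel{F}y\Leftrightarrow f(x)\mathrel{F'}f(y)$ if and only if $\mathrm{gfs}(E,F)=\mathrm{gfs}(E',F')$.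 -/

import Mathlib

universe u

open Cardinal

/-- An equivalence relation `E` on `X` is smooth if some Borel map into a standard Borel
space `W` is a reduction of `E` to equality on `W`. -/
def IsSmooth {X : Type u} [MeasurableSpace X] (E : Setoid X) : Prop :=
  ∃ (W : Type u) (_ : MeasurableSpace W) (_ : StandardBorelSpace W) (f : X → W),
    Measurable f ∧ ∀ x y, E x y ↔ f x = f y

/-- All equivalence classes of `E` are countable. -/
def HasCountableClasses {X : Type u} (E : Setoid X) : Prop :=
  ∀ x, {y | E x y}.Countable

/-- `E ⊆ F` is a pair of smooth countable equivalence relations on `X`. -/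
structure IsSmoothCountablePair {X : Type u} [MeasurableSpace X] (E F : Setoid X) : Prop where
  subset : ∀ x y, E x y → F x y
  smooth_left : IsSmooth E
  smooth_right : IsSmooth F
  countable_left : HasCountableClasses E
  countable_right : HasCountableClasses F

/-- The cardinalities of nonempty standard Borel spaces: `1, 2, 3, …`, `ℵ₀` and `𝔠`. -/
def BorelCard : Type (u + 1) :=
  {κ : Cardinal.{u} // κ ≠ 0 ∧ ((∃ n : ℕ, κ = n) ∨ κ = ℵ₀ ∨ κ = 𝔠)}

/-- A Borel parametrization of an equivalence relation `D` on `Q`: a Borel bijection of `Q` onto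
the disjoint union, over `m ∈ {1, 2, …, ℵ₀, 𝔠}`, of products `Z m × Y m` of standard Borel spaces
with `|Y m| = m`, under which `D` becomes equality of the coordinate in the disjoint union
of the `Z m`. -/
structure BorelParametrization {Q : Type u} [MeasurableSpace Q] (D : Setoid Q) where
  Z : BorelCard.{u} → Type u
  Y : BorelCard.{u} → Type u
  [measurableSpaceZ : ∀ m, MeasurableSpace (Z m)]
  [measurableSpaceY : ∀ m, MeasurableSpace (Y m)]
  [standardBorelZ : ∀ m, StandardBorelSpace (Z m)]
  [standardBorelY : ∀ m, StandardBorelSpace (Y m)]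
  card_Y : ∀ m, #(Y m) = m.1
  toFun : Q → Σ m, Z m × Y m
  measurable_toFun : Measurable toFun
  bijective_toFun : Function.Bijective toFun
  rel_iff : ∀ p q, D p q ↔
    (⟨(toFun p).1, (toFun p).2.1⟩ : Σ m, Z m) = ⟨(toFun q).1, (toFun q).2.1⟩

/-- `D` admits a Borel parametrization. -/
def BorelParametrized {Q : Type u} [MeasurableSpace Q] (D : Setoid Q) : Prop :=
  Nonempty (BorelParametrization D)

/-- Sequences of elements of `{0, 1, …, ℵ₀}` indexed by the sizes `m` with `1 ≤ m ≤ ℵ₀`. -/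
abbrev ShapeSeq : Type := {m : ℕ∞ // 1 ≤ m} → ℕ∞

/-- The set of local fine shapes: the sequences that are not constantly zero. -/
def LocalFineShape : Type := {α : ShapeSeq // ∃ m, α m ≠ 0}

/-- The local fine shape of an `F`-class `C`: for each `1 ≤ m ≤ ℵ₀`, the number of `E`-classes of
size `m` contained in `C`. (When `F` is countable these are numbers in `{0, 1, …, ℵ₀}`.) -/
noncomputable def lfs {X : Type u} (E F : Setoid X) (C : Quotient F) : ShapeSeq := fun m =>
  {A : Set X | A ∈ E.classes ∧ A ⊆ {x | Quotient.mk F x = C} ∧ A.encard = m.1}.encard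

/-- The global fine shape of `(E, F)`: for each local fine shape `α`, the number of `F`-classes
whose local fine shape is `α`. -/
noncomputable def gfs {X : Type u} (E F : Setoid X) (α : LocalFineShape) : Cardinal.{u} :=
  #{C : Quotient F // lfs E F C = α.1}

/-- Simultaneous Borel isomorphism of the pairs `(E, F)` on `X` and `(E', F')` on `Y`. -/
def SimultaneouslyBorelIsomorphic {X Y : Type u} [MeasurableSpace X] [MeasurableSpace Y]
    (E F : Setoid X) (E' F' : Setoid Y) : Prop :=
  ∃ f : X → Y, Measurable f ∧ Function.Bijective f ∧
    (∀ x y, E x y ↔ E' (f x) (f y)) ∧ (∀ x y, F x y ↔ F' (f x) (f y))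

/-! An isomorphism carries E-classes to E'-classes of the same size, hence preserves local fine
shapes and their multiplicities; this is the easy direction.

For the converse, Lusin–Novikov (`isSigmaInjOn_univ`) does the Borel work. It lets the fibers of a
countable-to-one Borel map be numbered without gaps in a Borel way, which makes the quotients
standard Borel and `lfs` a Borel map. It also gives each point four coordinates: its F-class C, the
size of its E-class, the index of that class among those of its size in C, and its index in the
class (`exists_borel_coordinates`). Which coordinates occur over C depends only on the local fine
shape of C, so any Borel bijection X/F → Y/F' preserving shapes lifts by acting on the first
coordinate alone.

Such a bijection comes from the parametrizations. The F-classes of a given shape form a copy of `Y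
m`, where m is their number; equal global shapes give the same m on both sides, and standard Borel
spaces of equal cardinality are Borel isomorphic. -/

/-! ### Lusin–Novikov, by Baire category on sequences within fibers. -/

section LusinNovikov

open Set Topology MeasureTheory TopologicalSpace

/-- `A` is covered by countably many Borel sets on each of which `f` is injective. -/
def IsSigmaInjOn {X Y : Type*} [MeasurableSpace X] (f : X → Y) (A : Set X) : Prop :=
  ∃ B : ℕ → Set X, (∀ n, MeasurableSet (B n)) ∧ (∀ n, InjOn f (B n)) ∧ A ⊆ ⋃ n, B n

namespace IsSigmaInjOn

variable {X Y : Type*} [MeasurableSpace X] {f : X → Y}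

theorem mono {A A' : Set X} (h : IsSigmaInjOn f A) (hA : A' ⊆ A) : IsSigmaInjOn f A' :=
  let ⟨B, hB, hi, hc⟩ := h
  ⟨B, hB, hi, hA.trans hc⟩

theorem of_injOn {A B : Set X} (hB : MeasurableSet B) (hi : InjOn f B) (hA : A ⊆ B) :
    IsSigmaInjOn f A :=
  ⟨fun _ => B, fun _ => hB, fun _ => hi, hA.trans (subset_iUnion (fun _ : ℕ => B) 0)⟩

theorem iUnion {ι : Type*} [Countable ι] {A : ι → Set X} (h : ∀ i, IsSigmaInjOn f (A i)) :
    IsSigmaInjOn f (⋃ i, A i) := by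
  rcases isEmpty_or_nonempty ι with hι | hι
  · exact of_injOn MeasurableSet.empty (injOn_empty f) (by simp)
  choose B hB hi hc using h
  obtain ⟨e, he⟩ := exists_surjective_nat (ι × ℕ)
  refine ⟨fun n => B (e n).1 (e n).2, fun n => hB _ _, fun n => hi _ _, ?_⟩
  refine iUnion_subset fun i x hx => ?_
  obtain ⟨n, hn⟩ := mem_iUnion.1 (hc i hx)
  obtain ⟨k, hk⟩ := he (i, n)
  exact mem_iUnion.2 ⟨k, by simpa [hk] using hn⟩

theorem union {A A' : Set X} (h : IsSigmaInjOn f A) (h' : IsSigmaInjOn f A') :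
    IsSigmaInjOn f (A ∪ A') := by
  rw [union_eq_iUnion]
  exact iUnion (by rintro (_ | _) <;> assumption)

theorem exists_measurableSet {A : Set X} (h : IsSigmaInjOn f A) :
    ∃ Z, MeasurableSet Z ∧ IsSigmaInjOn f Z ∧ A ⊆ Z :=
  let ⟨B, hB, hi, hc⟩ := h
  ⟨⋃ n, B n, MeasurableSet.iUnion hB, ⟨B, hB, hi, Subset.rfl⟩, hc⟩

end IsSigmaInjOn

section Topological

variable {X Y : Type*} [TopologicalSpace X] [PolishSpace X] [TopologicalSpace Y] [T2Space Y]
  {f : X → Y}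

theorem analyticSet_fiber_mates (hf : Continuous f) {A : Set X} (hA : AnalyticSet A) :
    AnalyticSet {x | ∃ a ∈ A, f a = f x ∧ a ≠ x} := by
  obtain ⟨β, _, _, g, hg, rfl⟩ := analyticSet_iff_exists_polishSpace_range.1 hA
  have hS : AnalyticSet ({p : β × X | f (g p.1) = f p.2} ∩ {p : β × X | g p.1 ≠ p.2}) := by
    borelize (β × X)
    refine MeasurableSet.analyticSet (MeasurableSet.inter ?_ ?_)
    · exact (isClosed_eq (by fun_prop) (by fun_prop)).measurableSet
    · exact (isOpen_ne_fun (by fun_prop) (by fun_prop)).measurableSet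
  convert hS.image_of_continuous continuous_snd using 1
  ext x
  simp

variable [MeasurableSpace X] [BorelSpace X]

/-- Separate twice: first A from the points sharing a fiber with another point of A, by B; then A
from the points sharing a fiber with another point of B, by B'. Two distinct points of B ∩ B' in one
fiber would contradict the second separation. -/
theorem exists_measurableSet_injOn_of_analyticSet (hf : Continuous f) {A : Set X}
    (hA : AnalyticSet A) (hi : InjOn f A) : ∃ B, MeasurableSet B ∧ A ⊆ B ∧ InjOn f B := by
  obtain ⟨B, hAB, hB, hBm⟩ := hA.measurablySeparable (analyticSet_fiber_mates hf hA) <| by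
    refine disjoint_left.2 ?_
    rintro x hx ⟨a, ha, h, hne⟩
    exact hne (hi ha hx h)
  obtain ⟨B', hAB', hB', hBm'⟩ := hA.measurablySeparable
    (analyticSet_fiber_mates hf hBm.analyticSet) <| by
    refine disjoint_left.2 ?_
    rintro x hx ⟨b, hb, h, hne⟩
    exact disjoint_left.1 hB ⟨x, hx, h.symm, hne.symm⟩ hb
  refine ⟨B ∩ B', hBm.inter hBm', subset_inter hAB hAB', ?_⟩
  intro x hx y hy h
  by_contra hne
  exact disjoint_left.1 hB' ⟨x, hx.1, h, hne⟩ hy.2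

/-- Sequences outside `Z` all of whose terms lie in one fiber of `f`. -/
def fiberSeqs {X Y : Type*} (f : X → Y) (Z : Set X) : Set (ℕ → X) :=
  {x | (∀ i j, f (x i) = f (x j)) ∧ ∀ i, x i ∉ Z}

theorem measurableSet_fiberSeqs (hf : Continuous f) {Z : Set X} (hZ : MeasurableSet Z) :
    MeasurableSet (fiberSeqs f Z) := by
  have : fiberSeqs f Z =
      (⋂ i, ⋂ j, {x : ℕ → X | f (x i) = f (x j)}) ∩ ⋂ i, (fun x : ℕ → X => x i) ⁻¹' Zᶜ := by
    ext; simp [fiberSeqs]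
  rw [this]
  refine MeasurableSet.inter (.iInter fun i => .iInter fun j => ?_) (.iInter fun i => ?_)
  · exact (isClosed_eq (by fun_prop) (by fun_prop)).measurableSet
  · exact measurable_pi_apply i hZ.compl

/-- Up to a Borel set covered by countably many Borel sets of injectivity, every nonempty basic
open set of sequences in a fiber has large coordinate projections. -/
theorem exists_sigmaInjOn_saturated {X Y : Type*} [TopologicalSpace X] [PolishSpace X]
    [MeasurableSpace X] (f : X → Y) :
    ∃ Z, MeasurableSet Z ∧ IsSigmaInjOn f Z ∧ ∀ V ∈ countableBasis (ℕ → X), ∀ j,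
      (V ∩ fiberSeqs f Z).Nonempty → ¬ IsSigmaInjOn f ((fun x => x j) '' (V ∩ fiberSeqs f Z)) := by
  have key : ∀ V : countableBasis (ℕ → X), ∃ Z, MeasurableSet Z ∧ IsSigmaInjOn f Z ∧
      ((∃ Z', MeasurableSet Z' ∧ IsSigmaInjOn f Z' ∧ V.1 ∩ fiberSeqs f Z' = ∅) →
        V.1 ∩ fiberSeqs f Z = ∅) := by
    intro V
    by_cases h : ∃ Z', MeasurableSet Z' ∧ IsSigmaInjOn f Z' ∧ V.1 ∩ fiberSeqs f Z' = ∅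
    · obtain ⟨Z, h1, h2, h3⟩ := h
      exact ⟨Z, h1, h2, fun _ => h3⟩
    · exact ⟨∅, .empty, .of_injOn .empty (injOn_empty f) Subset.rfl, fun h' => (h h').elim⟩
  choose Z hZm hZs hZ using key
  have : Countable (countableBasis (ℕ → X)) := (countable_countableBasis _).to_subtype
  have hm : MeasurableSet (⋃ V, Z V) := .iUnion hZm
  have hs : IsSigmaInjOn f (⋃ V, Z V) := .iUnion hZs
  have anti : ∀ {Z₁ Z₂ : Set X}, Z₁ ⊆ Z₂ → fiberSeqs f Z₂ ⊆ fiberSeqs f Z₁ :=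
    fun h x hx => ⟨hx.1, fun i hi => hx.2 i (h hi)⟩
  refine ⟨⋃ V, Z V, hm, hs, ?_⟩
  intro V hV j ⟨x, hxV, hx⟩ hsmall
  obtain ⟨S, hSm, hSs, hS⟩ := hsmall.exists_measurableSet
  -- If the projection were small, adding it to Z would empty V of fiber sequences, so the set
  -- chosen for V already does.
  have hempty : V ∩ fiberSeqs f (Z ⟨V, hV⟩) = ∅ := by
    refine hZ ⟨V, hV⟩ ⟨(⋃ V, Z V) ∪ S, hm.union hSm, hs.union hSs, ?_⟩
    refine eq_empty_of_forall_notMem fun y hy => ?_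
    exact hy.2.2 j (Or.inr (hS ⟨y, ⟨hy.1, anti subset_union_left hy.2⟩, rfl⟩))
  exact (eq_empty_iff_forall_notMem.1 hempty) x ⟨hxV, anti (subset_iUnion Z _) hx⟩

/-- Given a sequence in a fiber, a nearby one accumulates within `ε` at the `j`-th term. -/
theorem exists_fiberSeqs_near {X : Type*} [MetricSpace X] [PolishSpace X] [MeasurableSpace X]
    [BorelSpace X] {f : X → Y} (hf : Continuous f) {Z : Set X} (hZm : MeasurableSet Z)
    (hZ : ∀ V ∈ countableBasis (ℕ → X), ∀ j, (V ∩ fiberSeqs f Z).Nonempty →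
      ¬ IsSigmaInjOn f ((fun x => x j) '' (V ∩ fiberSeqs f Z)))
    {x : ℕ → X} (hx : x ∈ fiberSeqs f Z) {U : Set (ℕ → X)} (hU : IsOpen U) (hxU : x ∈ U)
    (j : ℕ) {ε : ℝ} (hε : 0 < ε) :
    ∃ y ∈ U ∩ fiberSeqs f Z, ∃ i, y i ≠ y j ∧ dist (y i) (y j) < ε := by
  have hW : IsOpen (U ∩ {y : ℕ → X | dist (y j) (x j) < ε / 2}) :=
    hU.inter (isOpen_lt (by fun_prop) (by fun_prop))
  obtain ⟨V, hV, hxV, hVW⟩ := (isBasis_countableBasis (ℕ → X)).exists_subset_of_mem_open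
    (show x ∈ U ∩ {y : ℕ → X | dist (y j) (x j) < ε / 2} from ⟨hxU, by simpa using hε⟩) hW
  have hVo : IsOpen V := (isBasis_countableBasis (ℕ → X)).isOpen hV
  have hlarge := hZ V hV j ⟨x, hxV, hx⟩
  have hninj : ¬ InjOn f ((fun x => x j) '' (V ∩ fiberSeqs f Z)) := by
    intro hi
    have hAn : AnalyticSet ((fun x : ℕ → X => x j) '' (V ∩ fiberSeqs f Z)) :=
      (hVo.measurableSet.inter (measurableSet_fiberSeqs hf hZm)).analyticSet.image_of_continuous
        (continuous_apply j)
    obtain ⟨B, hB, hAB, hBi⟩ := exists_measurableSet_injOn_of_analyticSet hf hAn hi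
    exact hlarge (.of_injOn hB hBi hAB)
  simp only [InjOn, not_forall] at hninj
  obtain ⟨_, ⟨y, hy, rfl⟩, _, ⟨z, hz, rfl⟩, hyz, hne⟩ := hninj
  obtain ⟨I, u, hu, huV⟩ := isOpen_pi_iff.1 hVo y hy.1
  -- V constrains only the coordinates in I near y, so the term at a fresh index i can be replaced
  -- by `z j`, a point of the same fiber close to `y j`.
  obtain ⟨i, hi⟩ := Infinite.exists_notMem_finset (insert j I)
  rw [Finset.mem_insert, not_or] at hi
  have hyj : Function.update y i (z j) j = y j := Function.update_of_ne (Ne.symm hi.1) _ _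
  have hyi : Function.update y i (z j) i = z j := Function.update_self _ _ _
  have hfy : ∀ k, f (Function.update y i (z j) k) = f (y j) := by
    intro k
    rcases eq_or_ne k i with rfl | hk
    · rw [hyi]; exact hyz.symm
    · rw [Function.update_of_ne hk]; exact hy.2.1 k j
  refine ⟨Function.update y i (z j), ⟨(hVW (huV ?_)).1, fun k l => (hfy k).trans (hfy l).symm, ?_⟩,
    i, ?_, ?_⟩
  · intro k hk
    rw [Function.update_of_ne (by rintro rfl; exact hi.2 hk)]
    exact (hu k hk).2
  · intro k
    rcases eq_or_ne k i with rfl | hk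
    · rw [hyi]; exact hz.2.2 j
    · rw [Function.update_of_ne hk]; exact hy.2.2 k
  · rw [hyi, hyj]; exact fun h => hne h.symm
  · rw [hyi, hyj]
    have h1 : dist (y j) (x j) < ε / 2 := (hVW hy.1).2
    have h2 : dist (z j) (x j) < ε / 2 := (hVW hz.1).2
    linarith [dist_triangle_right (z j) (y j) (x j)]

/-- Otherwise, by Baire category, a generic sequence in the closure K of the saturated fiber
sequences has a range without isolated points. Its closure lies in one fiber and contains a Cantor
set, so that fiber is uncountable. -/
theorem isSigmaInjOn_univ_of_continuous (hf : Continuous f)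
    (hc : ∀ y, (f ⁻¹' {y}).Countable) : IsSigmaInjOn f univ := by
  by_contra hns
  let := upgradeIsCompletelyMetrizable X
  obtain ⟨Z, hZm, hZs, hZ⟩ := exists_sigmaInjOn_saturated f
  obtain ⟨x₀, hx₀⟩ : ∃ x, x ∉ Z := by
    by_contra! h
    exact hns (hZs.mono fun x _ => h x)
  set K : Set (ℕ → X) := closure (fiberSeqs f Z)
  have hK : IsClosed K := isClosed_closure
  have : PolishSpace K := hK.polishSpace
  have : Nonempty K := ⟨⟨fun _ => x₀, subset_closure ⟨fun _ _ => rfl, fun _ => hx₀⟩⟩⟩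
  have hKf : ∀ x ∈ K, ∀ i j, f (x i) = f (x j) := by
    intro x hx i j
    have hcl : IsClosed {x : ℕ → X | f (x i) = f (x j)} :=
      isClosed_eq (hf.comp (continuous_apply i)) (hf.comp (continuous_apply j))
    exact closure_minimal (fun y hy => hy.1 i j) hcl hx
  let O : ℕ × ℕ → Set (ℕ → X) := fun p =>
    ⋃ i, {x | x i ≠ x p.1 ∧ dist (x i) (x p.1) < 1 / ((p.2 : ℝ) + 1)}
  have hO : ∀ p, IsOpen (O p) := fun p => isOpen_iUnion fun i =>
    (isOpen_ne_fun (continuous_apply i) (continuous_apply p.1)).inter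
      (isOpen_lt ((continuous_apply i).dist (continuous_apply p.1)) continuous_const)
  have hdense : Dense (⋂ p, ((↑) : K → ℕ → X) ⁻¹' O p) := by
    refine dense_iInter_of_isOpen (fun p => (hO p).preimage continuous_subtype_val) fun p => ?_
    rw [dense_iff_inter_open]
    rintro W hW ⟨w, hw⟩
    obtain ⟨U, hU, rfl⟩ := isOpen_induced_iff.1 hW
    obtain ⟨x, hxU, hx⟩ := mem_closure_iff.1 w.2 U hU hw
    obtain ⟨y, hy, i, hne, hd⟩ := exists_fiberSeqs_near hf hZm hZ hx hU hxU p.1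
      (ε := 1 / ((p.2 : ℝ) + 1)) (by positivity)
    exact ⟨⟨y, subset_closure hy.2⟩, hy.1, mem_iUnion.2 ⟨i, hne, hd⟩⟩
  obtain ⟨x, hx⟩ := hdense.nonempty
  have hpre : Preperfect (range x.1) := by
    rw [preperfect_iff_nhds]
    rintro _ ⟨j, rfl⟩ U hU
    obtain ⟨ε, hε, hb⟩ := Metric.mem_nhds_iff.1 hU
    obtain ⟨n, hn⟩ := exists_nat_one_div_lt hε
    obtain ⟨i, hne, hd⟩ := mem_iUnion.1 (mem_iInter.1 hx (j, n))
    exact ⟨x.1 i, ⟨hb (hd.trans hn), mem_range_self i⟩, hne⟩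
  obtain ⟨g, hg, -, hgi⟩ :=
    hpre.perfect_closure.exists_nat_bool_injection ((range_nonempty x.1).closure)
  have hsub : range g ⊆ f ⁻¹' {f (x.1 0)} := by
    refine hg.trans (closure_minimal ?_ ((isClosed_singleton).preimage hf))
    rintro _ ⟨i, rfl⟩
    exact hKf x x.2 i 0
  have hcount : Countable (ℕ → Bool) := by
    have := ((hc _).mono hsub).to_subtype
    exact (Equiv.ofInjective g hgi).countable_iff.2 this
  have hle := Cardinal.mk_le_aleph0_iff.2 hcount
  clear hcount
  exact (Cardinal.cantor ℵ₀).not_ge (by simpa using hle)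

end Topological

/-- Lusin–Novikov: a countable-to-one Borel function is injective on each member of some
countable Borel cover. -/
theorem isSigmaInjOn_univ {X Y : Type*} [MeasurableSpace X] [StandardBorelSpace X]
    [MeasurableSpace Y] [StandardBorelSpace Y] {f : X → Y} (hf : Measurable f)
    (hc : ∀ y, (f ⁻¹' {y}).Countable) : IsSigmaInjOn f univ := by
  obtain ⟨tX, hbX, hpX⟩ := StandardBorelSpace.polish (α := X)
  obtain ⟨tY, hbY, hpY⟩ := StandardBorelSpace.polish (α := Y)
  -- A finer Polish topology makes f continuous without changing the Borel sets.
  obtain ⟨t, ht, hcont, hpol⟩ := hf.exists_continuous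
  have hb : @BorelSpace X t _ :=
    @BorelSpace.mk X t _ (hbX.measurable_eq.trans
      (borel_eq_borel_of_le hpol hpX ht).symm)
  exact @isSigmaInjOn_univ_of_continuous X Y t hpol _ _ f _ hb hcont hc

end LusinNovikov

/-! ### Borel numbering of countable fibers, and Borel lifts. -/

section FiberEnumeration

open Set MeasureTheory MeasurableSpace

variable {X Y : Type*} [MeasurableSpace X] [StandardBorelSpace X]
  [MeasurableSpace Y] [StandardBorelSpace Y] {f : X → Y}

theorem MeasurableSet.image_of_countable_fibers {S : Set X} (hS : MeasurableSet S)
    (hf : Measurable f) (hc : ∀ y, (f ⁻¹' {y}).Countable) : MeasurableSet (f '' S) := by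
  obtain ⟨B, hB, hi, hcov⟩ := isSigmaInjOn_univ hf hc
  have : f '' S = ⋃ n, f '' (S ∩ B n) := by
    rw [← image_iUnion, ← inter_iUnion, univ_subset_iff.1 hcov, inter_univ]
  rw [this]
  exact .iUnion fun n =>
    (hS.inter (hB n)).image_of_measurable_injOn hf ((hi n).mono inter_subset_right)

theorem exists_measurable_nat_injOn_fibers (hf : Measurable f)
    (hc : ∀ y, (f ⁻¹' {y}).Countable) :
    ∃ i : X → ℕ, Measurable i ∧ ∀ x x', f x = f x' → i x = i x' → x = x' := by
  obtain ⟨B, hB, hi, hcov⟩ := isSigmaInjOn_univ hf hc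
  have hex : ∀ x, ∃ n, x ∈ disjointed B n := fun x => by
    have : x ∈ ⋃ n, disjointed B n := by rw [iUnion_disjointed]; exact hcov trivial
    exact mem_iUnion.1 this
  choose i hi' using hex
  refine ⟨i, measurable_to_countable' fun n => ?_, fun x x' h h' => ?_⟩
  · have : i ⁻¹' {n} = disjointed B n := by
      ext x
      refine ⟨fun h => h ▸ hi' x, fun h => ?_⟩
      by_contra hne
      exact disjoint_left.1 (disjoint_disjointed B hne) (hi' x) h
    rw [this]
    exact .disjointed hB n
  · exact hi (i x) (disjointed_subset B _ (hi' x)) (disjointed_subset B _ (h' ▸ hi' x')) h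

theorem exists_count_eq_iff (S : Set ℕ) [DecidablePred (· ∈ S)] (n : ℕ) :
    (∃ k ∈ S, Nat.count (· ∈ S) k = n) ↔ (n : ℕ∞) < S.encard := by
  constructor
  · rintro ⟨k, hk, rfl⟩
    rcases S.finite_or_infinite with h | h
    · rw [h.encard_eq_coe_toFinset_card]
      exact_mod_cast Nat.count_lt_card (p := (· ∈ S)) h hk
    · rw [h.encard_eq]; exact ENat.natCast_lt_top _
  · intro h
    have h' : ∀ hf : (Set.ofPred (· ∈ S)).Finite, n < hf.toFinset.card := by
      intro hf
      have : (n : ℕ∞) < (hf.toFinset.card : ℕ∞) := by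
        rw [← hf.encard_eq_coe_toFinset_card]; exact h
      exact_mod_cast this
    exact ⟨Nat.nth (· ∈ S) n, Nat.nth_mem n h', Nat.count_nth h'⟩

open scoped Classical in
/-- The fibers of a countable-to-one Borel function can be enumerated, without gaps, in a Borel
way. -/
theorem exists_fiber_enumeration (hf : Measurable f) (hc : ∀ y, (f ⁻¹' {y}).Countable) :
    ∃ i : X → ℕ, Measurable i ∧ (∀ x x', f x = f x' → i x = i x' → x = x') ∧
      ∀ y n, (∃ x, f x = y ∧ i x = n) ↔ (n : ℕ∞) < (f ⁻¹' {y}).encard := by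
  obtain ⟨i, him, hi⟩ := exists_measurable_nat_injOn_fibers hf hc
  let S : Y → Set ℕ := fun y => i '' (f ⁻¹' {y})
  have hS : ∀ n, MeasurableSet {y | n ∈ S y} := fun n => by
    have : {y | n ∈ S y} = f '' (i ⁻¹' {n}) := by
      ext y
      simp only [S, mem_ofPred_eq, mem_image, mem_preimage, mem_singleton_iff]
      exact exists_congr fun x => and_comm
    rw [this]
    exact (him (measurableSet_singleton n)).image_of_countable_fibers hf hc
  have hcount : ∀ n, Measurable fun y => Nat.count (· ∈ S y) n := by
    intro n
    induction n with
    | zero => simp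
    | succ n ih =>
      simp only [Nat.count_succ]
      exact ih.add (Measurable.ite (hS n) measurable_const measurable_const)
  have hmem : ∀ x, i x ∈ S (f x) := fun x => ⟨x, rfl, rfl⟩
  -- Replacing each label by its rank among the labels used in the fiber removes the gaps.
  refine ⟨fun x => Nat.count (· ∈ S (f x)) (i x), ?_, ?_, ?_⟩
  · have : Measurable fun p : Y × ℕ => Nat.count (· ∈ S p.1) p.2 :=
      measurable_from_prod_countable_left hcount
    exact this.comp (hf.prodMk him)
  · intro x x' h h'
    refine hi x x' h (Nat.count_injective (p := (· ∈ S (f x))) (hmem x) (h ▸ hmem x') ?_)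
    simp only [h] at h' ⊢
    exact h'
  · intro y n
    have hinj : InjOn i (f ⁻¹' {y}) := fun x hx x' hx' h =>
      hi x x' (Eq.trans hx (Eq.symm hx')) h
    rw [← hinj.encard_image, ← exists_count_eq_iff]
    constructor
    · rintro ⟨x, rfl, h⟩
      exact ⟨i x, hmem x, h⟩
    · rintro ⟨_, ⟨x, rfl, rfl⟩, h⟩
      exact ⟨x, rfl, h⟩

theorem measurable_encard_fiber (hf : Measurable f) (hc : ∀ y, (f ⁻¹' {y}).Countable) :
    Measurable fun y => (f ⁻¹' {y}).encard := by
  obtain ⟨i, him, -, hi⟩ := exists_fiber_enumeration hf hc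
  have hlt : ∀ n : ℕ, MeasurableSet {y | (n : ℕ∞) < (f ⁻¹' {y}).encard} := fun n => by
    have : {y | (n : ℕ∞) < (f ⁻¹' {y}).encard} = f '' (i ⁻¹' {n}) := by
      ext y
      rw [mem_ofPred_eq, ← hi]
      exact exists_congr fun x => and_comm
    rw [this]
    exact (him (measurableSet_singleton n)).image_of_countable_fibers hf hc
  refine ENat.measurable_iff.2 fun n => ?_
  have : (fun y => (f ⁻¹' {y}).encard) ⁻¹' {(n : ℕ∞)} =
      {y | (n : ℕ∞) < (f ⁻¹' {y}).encard}ᶜ ∩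
        ⋂ k : Fin n, {y | ((k : ℕ) : ℕ∞) < (f ⁻¹' {y}).encard} := by
    ext y
    simp only [mem_preimage, mem_singleton_iff, mem_inter_iff, mem_compl_iff, mem_ofPred_eq, not_lt,
      mem_iInter]
    constructor
    · intro h
      rw [h]
      exact ⟨le_rfl, fun k => by exact_mod_cast k.2⟩
    · rintro ⟨h1, h2⟩
      obtain ⟨c, hc⟩ := ENat.ne_top_iff_exists.1 (ne_top_of_le_ne_top (ENat.natCast_ne_top n) h1)
      rw [← hc] at h1 h2 ⊢
      norm_cast at h1 ⊢
      refine le_antisymm h1 (not_lt.1 fun hcn => ?_)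
      have := h2 ⟨c, hcn⟩
      exact lt_irrefl _ (by exact_mod_cast this)
  rw [this]
  exact (hlt n).compl.inter (.iInter fun k => hlt k)

theorem exists_measurable_lift {X Y T : Type*} [MeasurableSpace X] [MeasurableSpace Y]
    [MeasurableSpace T] {j : Y → T} {u : X → T}
    (hj : MeasurableEmbedding j) (hu : Measurable u) (h : range u ⊆ range j) :
    ∃ g : X → Y, Measurable g ∧ ∀ x, j (g x) = u x := by
  choose g hg using fun x => h (mem_range_self x)
  refine ⟨g, fun S hS => ?_, hg⟩
  have : g ⁻¹' S = u ⁻¹' (j '' S) := by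
    ext x
    rw [mem_preimage, mem_preimage, ← hg x, hj.injective.mem_set_image]
  rw [this]
  exact hu (hj.measurableSet_image' hS)

theorem MeasurableEmbedding.standardBorelSpace {Q : Type*} [MeasurableSpace Q] {g : Q → Y}
    (hg : MeasurableEmbedding g) : StandardBorelSpace Q := by
  obtain ⟨t, ht, hp⟩ := (hg.measurableSet_range.standardBorel).polish
  let e := hg.equivRange
  let tQ : TopologicalSpace Q := TopologicalSpace.induced e t
  let h : Q ≃ₜ range g := e.toEquiv.toHomeomorphOfIsInducing ⟨rfl⟩
  have : PolishSpace Q := h.isClosedEmbedding.polishSpace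
  have : BorelSpace Q := e.measurableEmbedding.borelSpace h.isInducing
  exact standardBorel_of_polish

end FiberEnumeration

/-! ### Quotients by smooth countable equivalence relations. -/

section Quotients

open Set MeasureTheory MeasurableSpace

theorem StandardBorelSpace.quotient {X : Type u} [MeasurableSpace X] [StandardBorelSpace X]
    {E : Setoid X} (hs : IsSmooth E) (hc : HasCountableClasses E) :
    StandardBorelSpace (Quotient E) := by
  obtain ⟨W, _, _, f, hf, hE⟩ := hs
  have hcf : ∀ w, (f ⁻¹' {w}).Countable := fun w => by
    rcases (f ⁻¹' {w}).eq_empty_or_nonempty with h | ⟨x, rfl⟩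
    · simp [h]
    · exact (hc x).mono fun y hy => (hE x y).2 (Eq.symm hy)
  -- The reduction is countable-to-one, so it sends Borel sets to Borel sets and embeds the quotient
  -- in W.
  let g : Quotient E → W := Quotient.lift f fun a b h => (hE a b).1 h
  have hg : MeasurableEmbedding g :=
    { injective := by
        rintro ⟨a⟩ ⟨b⟩ h
        exact Quotient.sound ((hE a b).2 h)
      measurable := measurable_from_quotient.2 hf
      measurableSet_image' := fun S hS => by
        have : g '' S = f '' (Quotient.mk E ⁻¹' S) := by
          ext w
          constructor
          · rintro ⟨⟨a⟩, ha, rfl⟩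
            exact ⟨a, ha, rfl⟩
          · rintro ⟨a, ha, rfl⟩
            exact ⟨_, ha, rfl⟩
        rw [this]
        exact MeasurableSet.image_of_countable_fibers (measurable_quotient_mk'' hS) hf hcf }
  exact hg.standardBorelSpace

theorem HasCountableClasses.countable_mk_preimage {X : Type u} {E : Setoid X}
    (hc : HasCountableClasses E) (p : Quotient E) : (Quotient.mk E ⁻¹' {p}).Countable := by
  obtain ⟨x, rfl⟩ := Quotient.exists_rep p
  exact (hc x).mono fun y hy => Setoid.symm' E (Quotient.exact hy)

end Quotients

/-! ### Measurability of local fine shapes, and Borel coordinates. -/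

section LocalFineShapes

open Set MeasureTheory MeasurableSpace

variable {X : Type u} {E F : Setoid X}

/-- The map `X/E → X/F × {0, 1, …, ℵ₀}` sending an `E`-class to the `F`-class containing it and to
its own cardinality. -/
noncomputable def classAndCard (h : ∀ x y, E x y → F x y) (p : Quotient E) : Quotient F × ℕ∞ :=
  (Quotient.lift (Quotient.mk F) (fun a b hab => Quotient.sound (h a b hab)) p,
    (Quotient.mk E ⁻¹' {p}).encard)

/-- Turns the shape into fiber sizes of a countable-to-one map, to which `measurable_encard_fiber`
and `exists_fiber_enumeration` apply. -/
theorem lfs_eq_encard_classAndCard (h : ∀ x y, E x y → F x y) (C : Quotient F)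
    (m : {m : ℕ∞ // 1 ≤ m}) : lfs E F C m = (classAndCard h ⁻¹' {(C, m.1)}).encard := by
  have hinj : Function.Injective fun p : Quotient E => Quotient.mk E ⁻¹' {p} := by
    rintro ⟨a⟩ q hq
    have : a ∈ Quotient.mk E ⁻¹' {q} := by
      have ha : a ∈ Quotient.mk E ⁻¹' {Quotient.mk E a} := rfl
      exact (show Quotient.mk E ⁻¹' {Quotient.mk E a} = Quotient.mk E ⁻¹' {q} from hq) ▸ ha
    exact this
  rw [← hinj.encard_image, lfs]
  congr 1
  ext A
  constructor
  · rintro ⟨⟨x, rfl⟩, hA, hcard⟩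
    have heq : {y | E y x} = Quotient.mk E ⁻¹' {Quotient.mk E x} := by
      ext y
      exact Quotient.eq.symm
    refine ⟨Quotient.mk E x, Prod.ext (hA (E.refl' x)) ?_, heq.symm⟩
    rw [← hcard, heq]
    rfl
  · rintro ⟨p, hp, rfl⟩
    obtain ⟨x, rfl⟩ := Quotient.exists_rep p
    refine ⟨⟨x, ?_⟩, fun y hy => ?_, congrArg Prod.snd hp⟩
    · ext y
      exact Quotient.eq
    · have hx : Quotient.mk F x = C := congrArg Prod.fst hp
      rw [mem_ofPred_eq, ← hx]
      exact Quotient.sound (h _ _ (Quotient.exact hy))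

theorem exists_lfs_ne_zero (h : ∀ x y, E x y → F x y) (C : Quotient F) :
    ∃ m, lfs E F C m ≠ 0 := by
  obtain ⟨x, rfl⟩ := Quotient.exists_rep C
  refine ⟨⟨(Quotient.mk E ⁻¹' {Quotient.mk E x}).encard, ?_⟩, ?_⟩
  · exact one_le_encard_iff_nonempty.2 ⟨x, rfl⟩
  · rw [lfs_eq_encard_classAndCard h, encard_ne_zero]
    exact ⟨Quotient.mk E x, rfl⟩

theorem countable_classAndCard_preimage [MeasurableSpace X] (hEF : IsSmoothCountablePair E F)
    (c : Quotient F × ℕ∞) :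
    (classAndCard hEF.subset ⁻¹' {c}).Countable := by
  refine ((hEF.countable_right.countable_mk_preimage c.1).image (Quotient.mk E)).mono ?_
  rintro ⟨x⟩ hx
  exact ⟨x, congrArg Prod.fst hx, rfl⟩

section Borel

variable [MeasurableSpace X] [StandardBorelSpace X]

theorem measurable_classAndCard (hEF : IsSmoothCountablePair E F) :
    Measurable (classAndCard hEF.subset) := by
  have := StandardBorelSpace.quotient hEF.smooth_left hEF.countable_left
  refine Measurable.prodMk (measurable_from_quotient.2 measurable_quotient_mk'') ?_
  exact measurable_encard_fiber (f := Quotient.mk E) measurable_quotient_mk''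
    hEF.countable_left.countable_mk_preimage

theorem measurable_lfs (hEF : IsSmoothCountablePair E F) : Measurable (lfs E F) := by
  have := StandardBorelSpace.quotient hEF.smooth_left hEF.countable_left
  have := StandardBorelSpace.quotient hEF.smooth_right hEF.countable_right
  refine measurable_pi_lambda _ fun m => ?_
  simp only [lfs_eq_encard_classAndCard hEF.subset]
  exact (measurable_encard_fiber (measurable_classAndCard hEF)
    (countable_classAndCard_preimage hEF)).comp measurable_prodMk_right

/-- Borel coordinates for a pair of smooth countable equivalence relations: the `F`-class, the size
of the `E`-class, the index of the `E`-class among those of its size, and the index of the point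
in its `E`-class. -/
theorem exists_borel_coordinates (hEF : IsSmoothCountablePair E F) :
    ∃ Θ : X → Quotient F × ℕ∞ × ℕ × ℕ, MeasurableEmbedding Θ ∧ (∀ x, (Θ x).1 = Quotient.mk F x) ∧
      (∀ x y, E x y ↔ (Θ x).1 = (Θ y).1 ∧ (Θ x).2.1 = (Θ y).2.1 ∧ (Θ x).2.2.1 = (Θ y).2.2.1) ∧
      ∀ c, c ∈ range Θ ↔ ∃ m : {m : ℕ∞ // 1 ≤ m}, c.2.1 = m.1 ∧
        (c.2.2.1 : ℕ∞) < lfs E F c.1 m ∧ (c.2.2.2 : ℕ∞) < c.2.1 := by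
  have := StandardBorelSpace.quotient hEF.smooth_left hEF.countable_left
  have := StandardBorelSpace.quotient hEF.smooth_right hEF.countable_right
  obtain ⟨k, hkm, hk, hkr⟩ := exists_fiber_enumeration (f := Quotient.mk E)
    measurable_quotient_mk'' hEF.countable_left.countable_mk_preimage
  obtain ⟨i, him, hi, hir⟩ := exists_fiber_enumeration (measurable_classAndCard hEF)
    (countable_classAndCard_preimage hEF)
  have hmk : Measurable (Quotient.mk E) := measurable_quotient_mk''
  have hE : ∀ x y, E x y ↔ classAndCard hEF.subset (Quotient.mk E x) =
      classAndCard hEF.subset (Quotient.mk E y) ∧ i (Quotient.mk E x) = i (Quotient.mk E y) := by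
    intro x y
    constructor
    · intro h
      rw [Quotient.sound h]
      exact ⟨rfl, rfl⟩
    · rintro ⟨h, h'⟩
      exact Quotient.exact (hi _ _ h h')
  let Θ : X → Quotient F × ℕ∞ × ℕ × ℕ := fun x =>
    ((classAndCard hEF.subset (Quotient.mk E x)).1, (classAndCard hEF.subset (Quotient.mk E x)).2,
      i (Quotient.mk E x), k x)
  have hΘm : Measurable Θ :=
    (((measurable_classAndCard hEF).comp hmk).fst).prodMk
      ((((measurable_classAndCard hEF).comp hmk).snd).prodMk ((him.comp hmk).prodMk hkm))
  have hΘE : ∀ x y, E x y ↔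
      (Θ x).1 = (Θ y).1 ∧ (Θ x).2.1 = (Θ y).2.1 ∧ (Θ x).2.2.1 = (Θ y).2.2.1 := by
    intro x y
    rw [hE, Prod.ext_iff, and_assoc]
  have hΘi : Function.Injective Θ := fun x y h =>
    hk x y (Quotient.sound ((hΘE x y).2 ⟨by rw [h], by rw [h], by rw [h]⟩))
      (congrArg (fun c => c.2.2.2) h)
  refine ⟨Θ, hΘm.measurableEmbedding hΘi, fun x => rfl, hΘE, ?_⟩
  rintro ⟨C, m, a, b⟩
  constructor
  · rintro ⟨x, hx⟩
    obtain ⟨rfl, rfl, rfl, rfl⟩ : C = (Θ x).1 ∧ m = (Θ x).2.1 ∧ a = (Θ x).2.2.1 ∧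
      b = (Θ x).2.2.2 := by simp [hx]
    refine ⟨⟨(Θ x).2.1, one_le_encard_iff_nonempty.2 ⟨x, rfl⟩⟩, rfl, ?_, ?_⟩
    · rw [lfs_eq_encard_classAndCard hEF.subset]
      exact (hir _ _).1 ⟨Quotient.mk E x, rfl, rfl⟩
    · exact (hkr _ _).1 ⟨x, rfl, rfl⟩
  · rintro ⟨⟨m, hm⟩, rfl, ha, hb⟩
    rw [lfs_eq_encard_classAndCard hEF.subset] at ha
    obtain ⟨p, hp, rfl⟩ := (hir _ _).2 ha
    have hp2 : (Quotient.mk E ⁻¹' {p}).encard = m := congrArg Prod.snd hp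
    obtain ⟨x, rfl, rfl⟩ := (hkr p b).2 (by rw [hp2]; exact hb)
    refine ⟨x, ?_⟩
    simp only [Θ, hp]

end Borel

theorem lfs_comp_bijective {Y : Type u} {E' F' : Setoid Y} (f : X ≃ Y)
    (hE : ∀ x y, E x y ↔ E' (f x) (f y)) (hF : ∀ x y, F x y ↔ F' (f x) (f y)) (C : Quotient F) :
    lfs E' F' (Quotient.congr f hF C) = lfs E F C := by
  obtain ⟨c, rfl⟩ := Quotient.exists_rep C
  funext m
  rw [lfs, lfs, ← (image_injective.2 f.injective).encard_image]
  congr 1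
  ext A
  constructor
  · rintro ⟨⟨y, rfl⟩, hA, hcard⟩
    obtain ⟨x, rfl⟩ := f.surjective y
    have himg : f '' {z | E z x} = {z | E' z (f x)} := by
      ext z
      obtain ⟨z, rfl⟩ := f.surjective z
      simp [hE]
    refine ⟨{z | E z x}, ⟨⟨x, rfl⟩, fun z hz => ?_, ?_⟩, himg⟩
    · have : Quotient.mk F' (f z) = Quotient.mk F' (f c) := hA ((hE z x).1 hz)
      exact Quotient.sound ((hF z c).2 (Quotient.exact this))
    · rw [← hcard, ← himg, f.injective.encard_image]
  · rintro ⟨A, ⟨⟨x, rfl⟩, hA, hcard⟩, rfl⟩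
    refine ⟨⟨f x, ?_⟩, ?_, ?_⟩
    · ext z
      obtain ⟨z, rfl⟩ := f.surjective z
      simp [hE]
    · rintro _ ⟨z, hz, rfl⟩
      have : Quotient.mk F z = Quotient.mk F c := hA hz
      exact Quotient.sound ((hF z c).1 (Quotient.exact this))
    · rw [f.injective.encard_image, hcard]

end LocalFineShapes

/-! ### Matching two parametrizations with equal class sizes. -/

section Parametrizations

open Set MeasureTheory MeasurableSpace

attribute [instance] BorelParametrization.measurableSpaceZ BorelParametrization.measurableSpaceY
  BorelParametrization.standardBorelZ BorelParametrization.standardBorelY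

theorem measurable_sigma_dom {ι : Type*} {β : ι → Type*} [∀ i, MeasurableSpace (β i)] {T : Type*}
    [MeasurableSpace T] {g : (Σ i, β i) → T} (hg : ∀ i, Measurable fun b : β i => g ⟨i, b⟩) :
    Measurable g := by
  intro S hS
  refine measurableSet_iInf.2 fun i => ?_
  exact hg i hS

namespace BorelParametrization

variable {Q : Type u} {T : Type*} [MeasurableSpace Q] {l : Q → T}

/-- The set where `l` takes a given value corresponds to a single fiber `{z} × Y m`. -/
theorem exists_fiber_description (P : BorelParametrization (Setoid.ker l)) (q₀ : Q) :
    ∃ (m : BorelCard.{u}) (z : P.Z m), m.1 = #{q // l q = l q₀} ∧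
      ∀ q, l q = l q₀ ↔ ∃ y, P.toFun q = ⟨m, (z, y)⟩ := by
  rcases h₀ : P.toFun q₀ with ⟨m, z, y₀⟩
  have hdesc : ∀ q, l q = l q₀ ↔ ∃ y, P.toFun q = ⟨m, (z, y)⟩ := by
    intro q
    have := P.rel_iff q q₀
    rw [Setoid.ker_def] at this
    rw [this, h₀]
    obtain ⟨m', z', y'⟩ := P.toFun q
    constructor
    · intro h
      obtain ⟨rfl, h⟩ := Sigma.mk.inj_iff.1 h
      obtain rfl := eq_of_heq h
      exact ⟨y', rfl⟩
    · rintro ⟨y, h⟩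
      obtain ⟨rfl, h⟩ := Sigma.mk.inj_iff.1 h
      obtain ⟨rfl, rfl⟩ := Prod.mk_inj.1 (eq_of_heq h)
      rfl
  refine ⟨m, z, ?_, hdesc⟩
  rw [← P.card_Y m]
  let φ := Equiv.ofBijective P.toFun P.bijective_toFun
  have hφ : ∀ y, P.toFun (φ.symm ⟨m, (z, y)⟩) = ⟨m, (z, y)⟩ := fun y => φ.apply_symm_apply _
  refine Cardinal.mk_congr (Equiv.ofBijective
    (fun y => ⟨φ.symm ⟨m, (z, y)⟩, (hdesc _).2 ⟨y, hφ y⟩⟩) ⟨?_, ?_⟩)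
  · intro y y' h
    have h₁ : φ.symm ⟨m, (z, y)⟩ = φ.symm ⟨m, (z, y')⟩ := congrArg Subtype.val h
    have h' := φ.symm.injective h₁
    exact (Prod.mk_inj.1 (eq_of_heq (Sigma.mk.inj_iff.1 h').2)).2
  · rintro ⟨q, hq⟩
    obtain ⟨y, hy⟩ := (hdesc q).1 hq
    exact ⟨y, Subtype.ext (φ.symm_apply_eq.2 hy.symm)⟩

variable {Q' : Type u} [MeasurableSpace Q'] {l' : Q' → T}

theorem injective_prodMk (P : BorelParametrization (Setoid.ker l)) {A : Type*}
    {r : ∀ m, P.Y m → A} (hr : ∀ m, Function.Injective (r m)) :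
    Function.Injective fun q => (l q, r (P.toFun q).1 (P.toFun q).2.2) := by
  intro q q' h
  obtain ⟨h1, h2⟩ := Prod.mk_inj.1 h
  obtain ⟨m, z, -, hd⟩ := P.exists_fiber_description q'
  obtain ⟨y, hy⟩ := (hd q).1 h1
  obtain ⟨y', hy'⟩ := (hd q').1 rfl
  rw [hy, hy'] at h2
  apply P.bijective_toFun.1
  have hyy : y = y' := hr m h2
  rw [hy, hy', hyy]

theorem range_prodMk_subset (P : BorelParametrization (Setoid.ker l))
    (P' : BorelParametrization (Setoid.ker l')) {A : Type*} {r : ∀ m, P.Y m → A}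
    {r' : ∀ m, P'.Y m → A} (hr : ∀ m y, ∃ y', r' m y' = r m y)
    (hcard : ∀ t, #{q // l q = t} = #{q // l' q = t}) :
    range (fun q => (l q, r (P.toFun q).1 (P.toFun q).2.2)) ⊆
      range (fun q => (l' q, r' (P'.toFun q).1 (P'.toFun q).2.2)) := by
  rintro _ ⟨q, rfl⟩
  obtain ⟨m, z, hm, hd⟩ := P.exists_fiber_description q
  obtain ⟨y, hy⟩ := (hd q).1 rfl
  have hne : #{q' // l' q' = l q} ≠ 0 := by
    rw [← hcard, ← hm]
    exact m.2.1
  obtain ⟨⟨q₁, hq₁⟩⟩ := Cardinal.mk_ne_zero_iff.1 hne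
  obtain ⟨m', z', hm', hd'⟩ := P'.exists_fiber_description q₁
  -- The index m is the cardinality of the class, so equal fiber sizes force equal indices.
  obtain rfl : m = m' := Subtype.ext (by rw [hm, hm', hq₁, hcard])
  obtain ⟨y', hy'⟩ := hr m y
  obtain ⟨q', hq'⟩ := P'.bijective_toFun.2 ⟨m, (z', y')⟩
  refine ⟨q', Prod.ext (((hd' q').2 ⟨y', hq'⟩).trans hq₁) ?_⟩
  dsimp only
  rw [hq', hy]
  exact hy'

/-- The value of l together with a real code for the `Y m` coordinate embeds each side in T × ℝ.
With codes matched through `P.Y m ≃ᵐ P'.Y m`, the two images coincide. Since l already identifies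
the class, the spaces `Z m` of the two sides need not be compared. -/
theorem exists_measurable_bijective [StandardBorelSpace Q] [StandardBorelSpace Q']
    [MeasurableSpace T] [StandardBorelSpace T] (hl : Measurable l) (hl' : Measurable l')
    (P : BorelParametrization (Setoid.ker l)) (P' : BorelParametrization (Setoid.ker l'))
    (hcard : ∀ t, #{q // l q = t} = #{q // l' q = t}) :
    ∃ G : Q → Q', Measurable G ∧ Function.Bijective G ∧ ∀ q, l' (G q) = l q := by
  have hc : ∀ m, Nonempty (P.Y m ≃ᵐ P'.Y m) := fun m =>
    (Cardinal.eq.1 ((P.card_Y m).trans (P'.card_Y m).symm)).map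
      PolishSpace.Equiv.measurableEquiv
  let c := fun m => (hc m).some
  let r : ∀ m, P.Y m → ℝ := fun m y => embeddingReal (P'.Y m) (c m y)
  let r' : ∀ m, P'.Y m → ℝ := fun m => embeddingReal (P'.Y m)
  have hr'i : ∀ m, Function.Injective (r' m) :=
    fun m => (measurableEmbedding_embeddingReal _).injective
  have hri : ∀ m, Function.Injective (r m) := fun m => (hr'i m).comp (c m).injective
  have hu : Measurable fun q => (l q, r (P.toFun q).1 (P.toFun q).2.2) :=
    hl.prodMk ((measurable_sigma_dom (g := fun s : Σ m, P.Z m × P.Y m => r s.1 s.2.2) fun m =>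
      (measurable_embeddingReal _).comp ((c m).measurable.comp measurable_snd)).comp
        P.measurable_toFun)
  have hu' : Measurable fun q => (l' q, r' (P'.toFun q).1 (P'.toFun q).2.2) :=
    hl'.prodMk ((measurable_sigma_dom (g := fun s : Σ m, P'.Z m × P'.Y m => r' s.1 s.2.2) fun m =>
      (measurable_embeddingReal _).comp measurable_snd).comp P'.measurable_toFun)
  obtain ⟨G, hG, hGu⟩ := exists_measurable_lift
    (hu'.measurableEmbedding (P'.injective_prodMk hr'i)) hu
    (range_prodMk_subset P P' (fun m y => ⟨c m y, rfl⟩) hcard)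
  refine ⟨G, hG, ⟨fun q q' h => ?_, fun q' => ?_⟩, fun q => congrArg Prod.fst (hGu q)⟩
  · refine P.injective_prodMk hri ?_
    dsimp only
    rw [← hGu, ← hGu, h]
  · obtain ⟨q, hq⟩ := range_prodMk_subset P' P (r := r') (r' := r)
      (fun m y => ⟨(c m).symm y, by simp [r, r']⟩) (fun t => (hcard t).symm) ⟨q', rfl⟩
    exact ⟨q, P'.injective_prodMk hr'i ((hGu q).trans hq)⟩

end BorelParametrization

end Parametrizations

/-! ### From global fine shapes to simultaneous isomorphism. -/

section Classification

open Set MeasureTheory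

variable {X Y : Type u} {E F : Setoid X} {E' F' : Setoid Y}

theorem gfs_eq_of_equiv (f : X ≃ Y) (hE : ∀ x y, E x y ↔ E' (f x) (f y))
    (hF : ∀ x y, F x y ↔ F' (f x) (f y)) : gfs E F = gfs E' F' := by
  funext α
  exact Cardinal.mk_congr ((Quotient.congr f hF).subtypeEquiv fun C => by
    rw [lfs_comp_bijective f hE hF])

theorem mk_lfs_fiber_eq_of_gfs_eq (h : ∀ x y, E x y → F x y) (h' : ∀ x y, E' x y → F' x y)
    (hg : gfs E F = gfs E' F') (α : ShapeSeq) :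
    #{C // lfs E F C = α} = #{C // lfs E' F' C = α} := by
  by_cases hα : ∃ m, α m ≠ 0
  · exact congrFun hg ⟨α, hα⟩
  -- The global shape is silent about the zero sequence, but every F-class contains an E-class, so
  -- that sequence never occurs.
  · have h1 : IsEmpty {C // lfs E F C = α} := ⟨by
      rintro ⟨C, rfl⟩
      exact hα (exists_lfs_ne_zero h C)⟩
    have h2 : IsEmpty {C // lfs E' F' C = α} := ⟨by
      rintro ⟨C, rfl⟩
      exact hα (exists_lfs_ne_zero h' C)⟩
    rw [Cardinal.mk_eq_zero, Cardinal.mk_eq_zero]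

/-- A Borel bijection of the quotients that preserves local fine shapes lifts to the spaces. -/
theorem simultaneouslyBorelIsomorphic_of_quotient_bijective [MeasurableSpace X]
    [StandardBorelSpace X] [MeasurableSpace Y] [StandardBorelSpace Y]
    (hEF : IsSmoothCountablePair E F) (hEF' : IsSmoothCountablePair E' F')
    {G : Quotient F → Quotient F'} (hG : Measurable G) (hGb : Function.Bijective G)
    (hGl : ∀ C, lfs E' F' (G C) = lfs E F C) : SimultaneouslyBorelIsomorphic E F E' F' := by
  obtain ⟨Θ, hΘ, hΘF, hΘE, hΘr⟩ := exists_borel_coordinates hEF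
  obtain ⟨Θ', hΘ', hΘF', hΘE', hΘr'⟩ := exists_borel_coordinates hEF'
  -- Membership in either range depends on the F-class only through its shape, which G preserves.
  have hmem : ∀ c : Quotient F × ℕ∞ × ℕ × ℕ, (G c.1, c.2) ∈ range Θ' ↔ c ∈ range Θ := by
    intro c
    simp only [hΘr, hΘr', hGl]
  have hu : Measurable fun x => (G (Θ x).1, (Θ x).2) :=
    (hG.comp hΘ.measurable.fst).prodMk hΘ.measurable.snd
  obtain ⟨f, hf, hfu⟩ := exists_measurable_lift hΘ' hu (by
    rintro _ ⟨x, rfl⟩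
    exact (hmem _).2 ⟨x, rfl⟩)
  have h1 : ∀ x y, (Θ' (f x)).1 = (Θ' (f y)).1 ↔ (Θ x).1 = (Θ y).1 := fun x y => by
    simp only [hfu, hGb.1.eq_iff]
  have h2 : ∀ x, (Θ' (f x)).2 = (Θ x).2 := fun x => by rw [hfu]
  refine ⟨f, hf, ⟨fun x y h => ?_, fun y => ?_⟩, fun x y => ?_, fun x y => ?_⟩
  · exact hΘ.injective (Prod.ext ((h1 x y).1 (by rw [h])) (by rw [← h2, ← h2, h]))
  · obtain ⟨C, hC⟩ := hGb.2 (Θ' y).1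
    obtain ⟨x, hx⟩ := (hmem (C, (Θ' y).2)).1 ⟨y, by rw [hC]⟩
    exact ⟨x, hΘ'.injective (by rw [hfu, hx, hC])⟩
  · rw [hΘE, hΘE', h1, h2, h2]
  · have := h1 x y
    rw [hΘF, hΘF, hΘF', hΘF'] at this
    exact (Quotient.eq.symm.trans this.symm).trans Quotient.eq

end Classification

theorem theorem6p6 {X Y : Type u}
    [MeasurableSpace X] [StandardBorelSpace X] [MeasurableSpace Y] [StandardBorelSpace Y]
    (E F : Setoid X) (E' F' : Setoid Y)
    (hEF : IsSmoothCountablePair E F) (hEF' : IsSmoothCountablePair E' F')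
    (hX : BorelParametrized (Setoid.ker (lfs E F)))
    (hY : BorelParametrized (Setoid.ker (lfs E' F'))) :
    SimultaneouslyBorelIsomorphic E F E' F' ↔ gfs E F = gfs E' F' := by
  constructor
  · rintro ⟨f, -, hf, hE, hF⟩
    exact gfs_eq_of_equiv (Equiv.ofBijective f hf) hE hF
  · intro hg
    have := StandardBorelSpace.quotient hEF.smooth_right hEF.countable_right
    have := StandardBorelSpace.quotient hEF'.smooth_right hEF'.countable_right
    obtain ⟨P⟩ := hX
    obtain ⟨P'⟩ := hY
    obtain ⟨G, hG, hGb, hGl⟩ := BorelParametrization.exists_measurable_bijective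
      (measurable_lfs hEF) (measurable_lfs hEF') P P'
      (mk_lfs_fiber_eq_of_gfs_eq hEF.subset hEF'.subset hg)
    exact simultaneouslyBorelIsomorphic_of_quotient_bijective hEF hEF' hG hGb hGl
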